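/- Consider finite words over $\{0,1\}$. A word is overlap-free if it contains no block (contiguous factor) of the form $axaxa$ with $a$ a single letter and $x$ a possibly empty word. A choice of one of the two letters as left parenthesis, the other being the right parenthesis, turns each binary word into a string of parentheses; the word is a Dyck word (for that choice) if the string is balanced. The nesting level $N$ of a Dyck word is given by $N(\epsilon)=0$, $N((u))=N(u)+1$ and $N(uv)=\max(N(u),N(v))$ for Dyck words $u,v$, where $(u)$ denotes $u$ enclosed in one pair of parentheses. Let $\mu$ be the Thue–Morse morphism, $\mu(0)=01$, $\mu(1)=10$. Define $x_0=10$, $x_{n+1}=\mu(101\,\mu(x_n)\,101)$ and $y_n=00\,x_n\,11$ for $n\ge 0$. Theorem. (i) For every $n\ge 0$ the word $y_n$ is overlap-free. (ii) For every $n\ge 1$ the word $y_n$, with $0$ as left and $1$ as right parenthesis, is a Dyck word of nesting level exactly $3$. (iii) Consequently, whichever of the two letters is taken as left parenthesis, for every $L$ there is an overlap-free binary Dyck word of length at least $L$ and nesting level exactly $3$. -/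

import Mathlib

namespace OverlapFreeDyck

/-- Finite binary words, over the letters `0` and `1`. -/
abbrev Word : Type := List (Fin 2)

/-- A word is overlap-free if it has no block (contiguous factor) of the form `a x a x a`,
where `a` is a single letter and `x` is a possibly empty word. -/
def OverlapFree (w : Word) : Prop :=
  ¬ ∃ (a : Fin 2) (x : Word), ([a] ++ x ++ [a] ++ x ++ [a]) <:+: w

/-- The images of the letters under the Thue–Morse morphism: `0 ↦ 01`, `1 ↦ 10`. -/
def muLetter : Fin 2 → Word
  | 0 => [0, 1]
  | 1 => [1, 0]

/-- The Thue–Morse morphism `μ` on words. -/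
def mu (w : Word) : Word := w.flatMap muLetter

/-- `x₀ = 10` and `xₙ₊₁ = μ(101 μ(xₙ) 101)`. -/
def x : ℕ → Word
  | 0 => [1, 0]
  | n + 1 => mu ([1, 0, 1] ++ mu (x n) ++ [1, 0, 1])

/-- `yₙ = 00 xₙ 11`. -/
def y (n : ℕ) : Word := [0, 0] ++ x n ++ [1, 1]

/-- Nesting level of a Dyck word. A nonempty Dyck word is uniquely `(p) q` with `p`, `q` Dyck
words (`p` is its inside part, `q` its outside part), and its level is
`max (level p + 1) (level q)`. The three defining equations are proved below. -/
def nestingLevel (p : DyckWord) : ℕ :=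
  if h : p = 0 then 0
  else max (nestingLevel p.insidePart + 1) (nestingLevel p.outsidePart)
termination_by p.semilength
decreasing_by
  · exact DyckWord.semilength_insidePart_lt h
  · exact DyckWord.semilength_outsidePart_lt h

theorem nestingLevel_zero : nestingLevel 0 = 0 := by
  rw [nestingLevel]; simp

theorem nestingLevel_nest (p : DyckWord) : nestingLevel p.nest = nestingLevel p + 1 := by
  rw [nestingLevel, dif_neg DyckWord.nest_ne_zero, DyckWord.insidePart_nest,
    DyckWord.outsidePart_nest, nestingLevel_zero]
  simp

theorem nestingLevel_add (p q : DyckWord) :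
    nestingLevel (p + q) = max (nestingLevel p) (nestingLevel q) := by
  by_cases h : p = 0
  · simp [h, nestingLevel_zero]
  · have h' : p + q ≠ 0 := by
      intro h0
      apply h
      have h1 := congrArg DyckWord.toList h0
      have h2 : p.toList ++ q.toList = [] := h1
      exact DyckWord.toList_eq_nil.mp (List.append_eq_nil_iff.mp h2).1
    rw [nestingLevel, dif_neg h', DyckWord.insidePart_add h, DyckWord.outsidePart_add h,
      nestingLevel_add p.outsidePart q]
    conv_rhs => rw [nestingLevel, dif_neg h]
    rw [max_assoc]
termination_by p.semilength
decreasing_by exact DyckWord.semilength_outsidePart_lt h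

/-- Reading a binary word as a string of parentheses: the letter `l` is the left parenthesis
and the other letter is the right parenthesis. -/
def parens (l : Fin 2) (w : Word) : List DyckStep :=
  w.map fun a => if a = l then DyckStep.U else DyckStep.D

/-- With the letter `l` as left parenthesis, `w` is a Dyck word, and its nesting level is `k`.
The Dyck word `p` is determined by `w`, hence so is `k`. -/
def IsDyckOfLevel (l : Fin 2) (w : Word) (k : ℕ) : Prop :=
  ∃ p : DyckWord, p.toList = parens l w ∧ nestingLevel p = k

end OverlapFreeDyck

/-!
An overlap `axaxa` is a block of length `2p + 1` with period `p`, where `p = |ax|`; the proof works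
with positions and periods throughout (`OverlapAt`).

*Overlap-freeness.* The morphism `μ` preserves overlap-freeness (`NoOverlapAt.mu`): an overlap of
even period in `μ(w)` descends to `w`, and one of odd period forces the letters to alternate over a
whole period, which contradicts the equality of its two ends. Now let `yₙ` be overlap-free and
`z = 101 μ(xₙ) 101`, so that `xₙ₊₁ = μ(z)`. The word `z` is a factor of `μ(yₙ)`, hence overlap-free.
Next `1 z 1` is overlap-free, hence so is `0 xₙ₊₁ 1`, a factor of `μ(1 z 1)`; and then so is
`yₙ₊₁ = 0 (0 xₙ₊₁ 1) 1`. In these two extensions by one letter on each side, a new overlap begins at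
the first letter or ends at the last, and the palindromicity of `z` reduces the second case to the
first. Both extended words have the form `aa μ(bab⋯) cd` with `a ≠ b`, so they begin with `aabaabb`,
and `aabaa` has no second occurrence far enough from the end, because the blocks of `μ` have
distinct letters; so no overlap begins at the first letter (`not_overlapAt_zero`).

*Nesting level.* One has `yₙ₊₁ = 0 · 01 · 0011 · (0 μ²(xₙ) 1) · 0011 · 01 · 1`, and `0 μ²(w) 1` is a
Dyck word of level at most `2` for every word `w` (`exists_dyckWord_mu_mu`).

For the other choice of left parenthesis the letters are exchanged.
-/

namespace OverlapFreeDyck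

/-! ### Overlaps by position and period -/

/-- The block of `w` of length `2p + 1` starting at position `i` has period `p > 0`, that is,
it is an overlap `axaxa` with `p = |ax|`. -/
def OverlapAt (w : Word) (i p : ℕ) : Prop :=
  0 < p ∧ i + 2 * p < w.length ∧ ∀ j ≤ p, w[i + j]? = w[i + j + p]?

/-- Overlap-freeness in terms of positions and periods. -/
def NoOverlapAt (w : Word) : Prop := ∀ i p, ¬ OverlapAt w i p

theorem NoOverlapAt.overlapFree {w : Word} (h : NoOverlapAt w) : OverlapFree w := by
  rintro ⟨a, v, s, t, rfl⟩
  refine h s.length (v.length + 1) ⟨by omega, by simp; omega, fun j hj => ?_⟩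
  have key : ∀ k, (s ++ ([a] ++ v ++ [a] ++ v ++ [a]) ++ t)[s.length + k]?
      = ((a :: v) ++ ((a :: v) ++ (a :: t)))[k]? := by
    intro k
    rw [List.append_assoc, List.getElem?_append_right (by omega)]
    simp
  have hright : ((a :: v) ++ ((a :: v) ++ (a :: t)))[j + (v.length + 1)]? =
      ((a :: v) ++ (a :: t))[j]? := by
    rw [List.getElem?_append_right (by simp)]
    simp
  rw [add_assoc, key, key, hright]
  rcases Nat.lt_or_ge j (v.length + 1) with hj' | hj'
  · rw [List.getElem?_append_left (by simpa using hj'),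
      List.getElem?_append_left (by simpa using hj')]
  · obtain rfl : j = v.length + 1 := by omega
    simp

theorem NoOverlapAt.of_append {s w t : Word} (h : NoOverlapAt (s ++ w ++ t)) :
    NoOverlapAt w := by
  rintro i p ⟨hp, hl, hj⟩
  have key : ∀ k < w.length, (s ++ w ++ t)[s.length + k]? = w[k]? := by
    intro k hk
    rw [List.append_assoc, List.getElem?_append_right (by omega),
      List.getElem?_append_left (by omega)]
    simp
  refine h (s.length + i) p ⟨hp, by simp; omega, fun j hjp => ?_⟩
  rw [show s.length + i + j = s.length + (i + j) by omega,
    show s.length + (i + j) + p = s.length + (i + j + p) by omega,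
    key _ (by omega), key _ (by omega)]
  exact hj j hjp

theorem OverlapAt.reverse {w : Word} {i p : ℕ} (h : OverlapAt w i p) :
    OverlapAt w.reverse (w.length - 1 - i - 2 * p) p := by
  obtain ⟨hp, hl, hj⟩ := h
  refine ⟨hp, by simp; omega, fun j hjp => ?_⟩
  rw [List.getElem?_reverse (by omega), List.getElem?_reverse (by omega)]
  have := hj (p - j) (by omega)
  rw [show w.length - 1 - (w.length - 1 - i - 2 * p + j) = i + (p - j) + p by omega,
    show w.length - 1 - (w.length - 1 - i - 2 * p + j + p) = i + (p - j) by omega]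
  exact this.symm

/-- A new overlap in `a w b` begins at its first letter or ends at its last, which is the
first letter of the reversed word. -/
theorem NoOverlapAt.extend {w : Word} (h : NoOverlapAt w) (a b : Fin 2)
    (h₁ : ∀ p, ¬ OverlapAt (a :: (w ++ [b])) 0 p)
    (h₂ : ∀ p, ¬ OverlapAt (a :: (w ++ [b])).reverse 0 p) :
    NoOverlapAt (a :: (w ++ [b])) := by
  intro i p hov
  obtain ⟨hp, hl, hj⟩ := id hov
  simp only [List.length_cons, List.length_append, List.length_nil] at hl
  rcases i with _ | i
  · exact h₁ p hov
  · rcases Nat.lt_or_ge (i + 2 * p) w.length with hlt | hge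
    · refine h i p ⟨hp, hlt, fun j hjp => ?_⟩
      have := hj j hjp
      rw [show i + 1 + j = i + j + 1 by omega,
        show i + j + 1 + p = i + j + p + 1 by omega, List.getElem?_cons_succ,
        List.getElem?_cons_succ, List.getElem?_append_left (by omega),
        List.getElem?_append_left (by omega)] at this
      exact this
    · apply h₂ p
      have := hov.reverse
      rwa [show (a :: (w ++ [b])).length - 1 - (i + 1) - 2 * p = 0 by
        simp; omega] at this

/-! ### The exchange of letters -/

/-- The word with the two letters exchanged. -/
def compl (w : Word) : Word := w.map (· + 1)

theorem NoOverlapAt.compl {w : Word} (h : NoOverlapAt w) : NoOverlapAt (compl w) := by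
  rintro i p ⟨hp, hl, hj⟩
  refine h i p ⟨hp, by simpa [OverlapFreeDyck.compl] using hl, fun j hjp => ?_⟩
  have := hj j hjp
  simp only [OverlapFreeDyck.compl, List.getElem?_map] at this
  exact Option.map_injective (add_left_injective 1) this

theorem parens_one_compl (w : Word) : parens 1 (compl w) = parens 0 w := by
  simp only [parens, compl, List.map_map]
  refine List.map_congr_left fun a _ => ?_
  fin_cases a <;> rfl

/-! ### The Thue–Morse morphism -/

theorem mu_nil : mu [] = [] := rfl

theorem mu_cons (a : Fin 2) (w : Word) : mu (a :: w) = a :: (a + 1) :: mu w := by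
  fin_cases a <;> rfl

theorem mu_append (v w : Word) : mu (v ++ w) = mu v ++ mu w := List.flatMap_append

theorem length_mu (w : Word) : (mu w).length = 2 * w.length := by
  induction w with
  | nil => rfl
  | cons a w ih => simp [mu_cons, ih]; omega

theorem mu_getElem?_even (w : Word) (k : ℕ) : (mu w)[2 * k]? = w[k]? := by
  induction w generalizing k with
  | nil => simp [mu_nil]
  | cons a w ih =>
    rcases k with _ | k
    · simp [mu_cons]
    · simp [mu_cons, Nat.mul_succ, ih]

theorem mu_getElem?_odd (w : Word) (k : ℕ) :
    (mu w)[2 * k + 1]? = w[k]?.map (· + 1) := by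
  induction w generalizing k with
  | nil => simp [mu_nil]
  | cons a w ih =>
    rcases k with _ | k
    · simp [mu_cons]
    · simp [mu_cons, Nat.mul_succ, ih]

theorem mu_getElem?_ne (w : Word) {k : ℕ} (hk : k < w.length) :
    (mu w)[2 * k]? ≠ (mu w)[2 * k + 1]? := by
  rw [mu_getElem?_even, mu_getElem?_odd, List.getElem?_eq_getElem hk]
  generalize w[k] = a
  revert a
  decide

theorem reverse_mu (w : Word) : (mu w).reverse = mu (compl w.reverse) := by
  induction w with
  | nil => rfl
  | cons a w ih =>
    have ha : a + 1 + 1 = a := by revert a; decide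
    simp [mu_cons, ih, compl, mu_append, mu_nil, ha]

theorem compl_mu (w : Word) : compl (mu w) = mu (compl w) := by
  induction w with
  | nil => rfl
  | cons a w ih =>
    simp only [compl] at ih
    simp [mu_cons, compl, ih]

theorem compl_compl (w : Word) : compl (compl w) = w := by
  have h : ∀ a : Fin 2, a + 1 + 1 = a := by decide
  simp [compl, Function.comp_def, h]

theorem NoOverlapAt.mu {w : Word} (h : NoOverlapAt w) : NoOverlapAt (mu w) := by
  rintro i p ⟨hp, hl, hj⟩
  rw [length_mu] at hl
  obtain ⟨q, rfl | rfl⟩ := Nat.even_or_odd' p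
  · obtain ⟨k, rfl | rfl⟩ := Nat.even_or_odd' i
    · refine h k q ⟨by omega, by omega, fun j hjq => ?_⟩
      have := hj (2 * j) (by omega)
      rwa [show 2 * k + 2 * j = 2 * (k + j) by ring,
        show 2 * (k + j) + 2 * q = 2 * (k + j + q) by ring, mu_getElem?_even,
        mu_getElem?_even] at this
    · refine h k q ⟨by omega, by omega, fun j hjq => ?_⟩
      have := hj (2 * j) (by omega)
      rw [show 2 * k + 1 + 2 * j = 2 * (k + j) + 1 by ring,
        show 2 * (k + j) + 1 + 2 * q = 2 * (k + j + q) + 1 by ring, mu_getElem?_odd,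
        mu_getElem?_odd] at this
      exact Option.map_injective (add_left_injective 1) this
  · -- Consecutive letters differ at an even position, being one block; at an odd position, the
    -- translate by the odd period is one block.
    have hne : ∀ j < 2 * q + 1,
        (OverlapFreeDyck.mu w)[i + j]? ≠ (OverlapFreeDyck.mu w)[i + j + 1]? := by
      intro j hjq
      obtain ⟨k, hk | hk⟩ := Nat.even_or_odd' (i + j)
      · rw [hk]
        exact mu_getElem?_ne w (by omega)
      · have h0 := hj j (by omega)
        have h1 := hj (j + 1) (by omega)
        rw [← add_assoc] at h1
        rw [h0, h1, show i + j + (2 * q + 1) = 2 * (k + q + 1) by omega,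
          show i + j + 1 + (2 * q + 1) = 2 * (k + q + 1) + 1 by omega]
        exact mu_getElem?_ne w (by omega)
    have halt : ∀ j ≤ q,
        (OverlapFreeDyck.mu w)[i + 2 * j]? = (OverlapFreeDyck.mu w)[i]? := by
      intro j
      induction j with
      | zero => simp
      | succ j ih =>
        intro hjq
        have h0 := ih (by omega)
        have h1 := hne (2 * j) (by omega)
        have h2 := hne (2 * j + 1) (by omega)
        rw [← h0]
        rw [show i + (2 * j + 1) = i + 2 * j + 1 by omega] at h2
        rw [show i + 2 * (j + 1) = i + 2 * j + 1 + 1 by omega]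
        rw [List.getElem?_eq_getElem (by rw [length_mu]; omega),
          List.getElem?_eq_getElem (by rw [length_mu]; omega)] at h1 h2 ⊢
        simp only [ne_eq, Option.some.injEq] at h1 h2 ⊢
        omega
    have h0 := hj 0 (by omega)
    have h1 := hne (2 * q) (by omega)
    rw [halt q le_rfl] at h1
    exact h1 h0

/-- Short periods are excluded by the prefix `aabaabb`; a longer one would repeat `aabaa`, which
contains `aa` at both parities, inside a product of blocks with distinct letters. -/
theorem not_overlapAt_zero {a b : Fin 2} (hab : a ≠ b) (t : Word) (c d : Fin 2) (p : ℕ) :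
    ¬ OverlapAt (a :: a :: (mu (b :: a :: b :: t) ++ [c, d])) 0 p := by
  rintro ⟨hp, hl, hj⟩
  obtain rfl : b = a + 1 := by omega
  set u : Word := (a + 1) :: a :: (a + 1) :: t with hu
  have hul : 3 ≤ u.length := by simp [hu]
  simp only [List.length_cons, List.length_append, length_mu, List.length_nil] at hl
  have hblock : ∀ k < u.length, (a :: a :: (mu u ++ [c, d]))[2 * k + 2]? ≠
      (a :: a :: (mu u ++ [c, d]))[2 * k + 3]? := by
    intro k hk
    simp only [List.getElem?_cons_succ]
    rw [List.getElem?_append_left (by rw [length_mu]; omega),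
      List.getElem?_append_left (by rw [length_mu]; omega)]
    exact mu_getElem?_ne u hk
  have haa : a + 1 + 1 = a := by omega
  have hW : a :: a :: (mu u ++ [c, d]) =
      a :: a :: (a + 1) :: a :: a :: (a + 1) :: (a + 1) :: a :: (mu t ++ [c, d]) := by
    simp [hu, mu_cons, haa]
  rcases Nat.lt_or_ge p 4 with h4 | h4
  · rw [hW] at hj
    interval_cases p
    · have := hj 1 (by omega)
      simp at this
    · have := hj 0 (by omega)
      simp at this
    · have := hj 3 (by omega)
      simp at this
  · have e0 := hj 0 (by omega)
    have e1 := hj 1 (by omega)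
    have e3 := hj 3 (by omega)
    have e4 := hj 4 (by omega)
    obtain ⟨k, hk | hk⟩ := Nat.even_or_odd' p
    · apply hblock (k - 1) (by omega)
      rw [show 2 * (k - 1) + 2 = 0 + 0 + p by omega,
        show 2 * (k - 1) + 3 = 0 + 1 + p by omega, ← e0, ← e1]
      simp
    · apply hblock (k + 1) (by omega)
      rw [show 2 * (k + 1) + 2 = 0 + 3 + p by omega,
        show 2 * (k + 1) + 3 = 0 + 4 + p by omega, ← e3, ← e4, hW]
      simp

/-! ### Overlap-freeness of `y n` -/

/-- `x n` is an antipalindrome; equivalently, the word `101 μ(x n) 101` is a palindrome. -/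
theorem reverse_x (n : ℕ) : (x n).reverse = compl (x n) := by
  induction n with
  | zero => rfl
  | succ n ih =>
    have h : ([1, 0, 1] ++ mu (x n) ++ [1, 0, 1]).reverse
        = [1, 0, 1] ++ mu (x n) ++ [1, 0, 1] := by
      simp [reverse_mu, ih, compl_compl]
    rw [x, reverse_mu, h, compl_mu]

theorem exists_x_eq (n : ℕ) : ∃ t, x n = 1 :: 0 :: t := by
  cases n with
  | zero => exact ⟨[], rfl⟩
  | succ n => exact ⟨_, rfl⟩

theorem noOverlapAt_y_zero : NoOverlapAt (y 0) := by
  rintro i p ⟨hp, hl, hj⟩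
  simp only [y, x, List.length_append, List.length_cons, List.length_nil] at hl
  have h0 := hj 0 (by omega)
  have h1 := hj 1 (by omega)
  have hlast := hj p le_rfl
  have hp' : p ≤ 2 := by omega
  have hi : i ≤ 3 := by omega
  interval_cases p <;> interval_cases i <;> first | omega | simp_all [y, x]

theorem noOverlapAt_y_succ {n : ℕ} (h : NoOverlapAt (y n)) : NoOverlapAt (y (n + 1)) := by
  obtain ⟨t, ht⟩ := exists_x_eq n
  have hmx : (mu (x n)).reverse = mu (x n) := by rw [reverse_mu, reverse_x, compl_compl]
  have hz : NoOverlapAt ([1, 0, 1] ++ mu (x n) ++ [1, 0, 1]) := by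
    apply NoOverlapAt.of_append (s := [0]) (t := [0])
    have := h.mu
    simpa [y, mu_append, mu_cons, mu_nil] using this
  have hzext : NoOverlapAt (1 :: (([1, 0, 1] ++ mu (x n) ++ [1, 0, 1]) ++ [1])) := by
    have hform : 1 :: (([1, 0, 1] ++ mu (x n) ++ [1, 0, 1]) ++ [1]) =
        1 :: 1 :: (mu (0 :: 1 :: 0 :: (t ++ [1])) ++ [1, 1]) := by
      simp [ht, mu_append, mu_cons, mu_nil]
    have hpal : (1 :: (([1, 0, 1] ++ mu (x n) ++ [1, 0, 1]) ++ [1])).reverse =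
        1 :: (([1, 0, 1] ++ mu (x n) ++ [1, 0, 1]) ++ [1]) := by
      simp [hmx]
    refine hz.extend 1 1 (fun p => ?_) (fun p => ?_)
    · rw [hform]
      exact not_overlapAt_zero (by decide) _ _ _ p
    · rw [hpal, hform]
      exact not_overlapAt_zero (by decide) _ _ _ p
  have hx : NoOverlapAt (0 :: (x (n + 1) ++ [1])) := by
    apply NoOverlapAt.of_append (s := [1]) (t := [0])
    have := hzext.mu
    simpa [x, mu_append, mu_cons, mu_nil] using this
  have hy : y (n + 1) = 0 :: ((0 :: (x (n + 1) ++ [1])) ++ [1]) := by simp [y]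
  rw [hy]
  refine hx.extend 0 1 (fun p => ?_) (fun p => ?_)
  · have hform : (0 : Fin 2) :: ((0 :: (x (n + 1) ++ [1])) ++ [1]) =
        0 :: 0 :: (mu (1 :: 0 :: 1 :: (mu (x n) ++ [1, 0, 1])) ++ [1, 1]) := by
      simp [x]
    rw [hform]
    exact not_overlapAt_zero (by decide) _ _ _ p
  · -- Reversing `y (n + 1)` amounts to exchanging its letters, so the prefix has the same shape.
    have hform : ((0 : Fin 2) :: ((0 :: (x (n + 1) ++ [1])) ++ [1])).reverse =
        1 :: 1 :: (mu (0 :: 1 :: 0 :: (compl (mu (x n) ++ [1, 0, 1]))) ++ [0, 0]) := by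
      have : ((0 : Fin 2) :: ((0 :: (x (n + 1) ++ [1])) ++ [1])).reverse =
        1 :: 1 :: ((x (n + 1)).reverse ++ [0, 0]) := by simp
      rw [this, reverse_x, x, compl_mu]
      rfl
    rw [hform]
    exact not_overlapAt_zero (by decide) _ _ _ p

theorem noOverlapAt_y (n : ℕ) : NoOverlapAt (y n) := by
  induction n with
  | zero => exact noOverlapAt_y_zero
  | succ n ih => exact noOverlapAt_y_succ ih

/-! ### Nesting level of `y n` -/

/-- The Dyck word `01`, with `0` as left parenthesis. -/
def pair : DyckWord := DyckWord.nest 0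

theorem nestingLevel_pair : nestingLevel pair = 1 := by
  rw [pair, nestingLevel_nest, nestingLevel_zero]

theorem toList_pair : pair.toList = [DyckStep.U, DyckStep.D] := rfl

theorem toList_nest (p : DyckWord) :
    p.nest.toList = DyckStep.U :: (p.toList ++ [DyckStep.D]) := rfl

theorem toList_add (p q : DyckWord) : (p + q).toList = p.toList ++ q.toList := rfl

theorem parens_append (l : Fin 2) (v w : Word) :
    parens l (v ++ w) = parens l v ++ parens l w := List.map_append

theorem parens_mu_mu_cons (a : Fin 2) (w : Word) :
    parens 0 (mu (mu (a :: w))) =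
      (if a = 0 then [DyckStep.U, DyckStep.D, DyckStep.D, DyckStep.U]
        else [DyckStep.D, DyckStep.U, DyckStep.U, DyckStep.D]) ++ parens 0 (mu (mu w)) := by
  fin_cases a <;> rfl

/-- The word `0 q μ²(w) 1` is a Dyck word of level at most `2`. The auxiliary `q` holds what has
been read since the last opening parenthesis at depth `0`: the blocks split as
`q 1001 = q) · (01` and `q 0110 = q 01) · (`. -/
theorem exists_dyckWord_mu_mu (w : Word) (q : DyckWord) (hq : nestingLevel q ≤ 1) :
    ∃ r : DyckWord, r.toList =
        DyckStep.U :: (q.toList ++ (parens 0 (mu (mu w)) ++ [DyckStep.D])) ∧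
      nestingLevel r ≤ 2 := by
  induction w generalizing q with
  | nil => exact ⟨q.nest, rfl, by rw [nestingLevel_nest]; omega⟩
  | cons a w ih =>
    by_cases ha : a = 0
    · obtain ⟨r, hr, hr2⟩ := ih 0 (by rw [nestingLevel_zero]; omega)
      refine ⟨(q + pair).nest + r, ?_, ?_⟩
      · have h0 : (0 : DyckWord).toList = [] := rfl
        simp [toList_add, toList_nest, toList_pair, hr, parens_mu_mu_cons, ha, h0]
      · rw [nestingLevel_add, nestingLevel_nest, nestingLevel_add, nestingLevel_pair]
        omega
    · obtain ⟨r, hr, hr2⟩ := ih pair nestingLevel_pair.le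
      refine ⟨q.nest + r, ?_, ?_⟩
      · simp [toList_add, toList_nest, toList_pair, hr, parens_mu_mu_cons, ha]
      · rw [nestingLevel_add, nestingLevel_nest]
        omega

theorem isDyckOfLevel_y_succ (n : ℕ) : IsDyckOfLevel 0 (y (n + 1)) 3 := by
  obtain ⟨r, hr, hr2⟩ := exists_dyckWord_mu_mu (x n) 0 (by rw [nestingLevel_zero]; omega)
  refine ⟨(pair + (pair.nest + (r + (pair.nest + pair)))).nest, ?_, ?_⟩
  · have h0 : (0 : DyckWord).toList = [] := rfl
    have hy : y (n + 1) = [0, 0, 1, 0, 0, 1, 1, 0] ++ mu (mu (x n)) ++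
        [1, 0, 0, 1, 1, 0, 1, 1] := by
      simp [y, x, mu_append, mu_cons, mu_nil]
    rw [hy, parens_append, parens_append]
    simp [toList_add, toList_nest, toList_pair, hr, h0, parens]
  · simp only [nestingLevel_nest, nestingLevel_add, nestingLevel_pair]
    omega

theorem IsDyckOfLevel.compl {w : Word} {k : ℕ} (h : IsDyckOfLevel 0 w k) :
    IsDyckOfLevel 1 (compl w) k := by
  rwa [IsDyckOfLevel, parens_one_compl]

theorem le_length_x (n : ℕ) : n ≤ (x n).length := by
  induction n with
  | zero => simp
  | succ n ih =>
    simp only [x, length_mu, List.length_append, List.length_cons, List.length_nil]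
    omega

end OverlapFreeDyck

theorem mainTheorem3 :
    (∀ n : ℕ, OverlapFreeDyck.OverlapFree (OverlapFreeDyck.y n)) ∧
    (∀ n : ℕ, 1 ≤ n → OverlapFreeDyck.IsDyckOfLevel 0 (OverlapFreeDyck.y n) 3) ∧
    (∀ (l : Fin 2) (L : ℕ), ∃ w : OverlapFreeDyck.Word, L ≤ w.length ∧
      OverlapFreeDyck.OverlapFree w ∧ OverlapFreeDyck.IsDyckOfLevel l w 3) := by
  refine ⟨fun n => (OverlapFreeDyck.noOverlapAt_y n).overlapFree, fun n hn => ?_, fun l L => ?_⟩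
  · obtain ⟨m, rfl⟩ := Nat.exists_eq_add_of_le' hn
    exact OverlapFreeDyck.isDyckOfLevel_y_succ m
  · have hfree := OverlapFreeDyck.noOverlapAt_y (L + 1)
    have hdyck := OverlapFreeDyck.isDyckOfLevel_y_succ L
    have hlen : L ≤ (OverlapFreeDyck.y (L + 1)).length := by
      have := OverlapFreeDyck.le_length_x (L + 1)
      simp only [OverlapFreeDyck.y, List.length_append]
      omega
    obtain rfl | rfl : l = 0 ∨ l = 1 := by omega
    · exact ⟨_, hlen, hfree.overlapFree, hdyck⟩
    · exact ⟨OverlapFreeDyck.compl (OverlapFreeDyck.y (L + 1)),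
        by simpa [OverlapFreeDyck.compl] using hlen, hfree.compl.overlapFree, hdyck.compl⟩
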